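/- Let $(\varphi_e)_{e\in\mathbb N}$ be a standard acceptable enumeration of the partial computable functions on $\mathbb N$, and let $W_e$ be the domain of $\varphi_e$. A recursive presentation is given by a computable set $X\subseteq\mathbb N$ of generators and a computably enumerable set of relators, which are words in the generators and their inverses. Its indices are the codes of pairs $(a,b)$ such that $\varphi_a$ is total and is the characteristic function of $X$, and $W_b$ is the set of codes of the relators, in a fixed standard coding of words by natural numbers. Let $A\subseteq\mathbb N$ be the set of all indices of recursive presentations. For $e\in A$ let $G_e$ be the group presented by the presentation with index $e$. A group is recursively presented (r.p.) if it is isomorphic to $G_e$ for some $e\in A$. A property $P$ of groups (invariant under isomorphism) is a Markov property for r.p. groups if there is an r.p. group $G_+$ that has $P$, and there is an r.p. group $G_-$ such that no group $H$ admitting an injective homomorphism $G_-\to H$ has $P$. Theorem. Let $P$ be a Markov property for r.p. groups. Then detecting $P$ is $\Pi^0_2$-hard in the class of r.p. groups. That is, for every $\Pi^0_2$ set $S\subseteq\mathbb N$ there is a computable function $f:\mathbb N\to\mathbb N$ with $f(n)\in A$ for all $n\in\mathbb N$, such that for all $n\in\mathbb N$, $n\in S$ if and only if $G_{f(n)}$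 has property $P$. -/

import Mathlib

namespace RPGroups

/-- The `e`-th partial computable function on the natural numbers, in the standard acceptable
enumeration. -/
def phi (e : ℕ) : ℕ →. ℕ := (Denumerable.ofNat Nat.Partrec.Code e).eval

/-- The `e`-th computably enumerable set: the domain of the `e`-th partial computable function. -/
def W (e : ℕ) : Set ℕ := {n | (phi e n).Dom}

/-- The set of natural numbers that the `a`-th partial computable function accepts, that is, on
which it halts with value `1`. -/
def gens (a : ℕ) : Set ℕ := {n | 1 ∈ phi a n}

/-- The code of a word in the generators from `X ⊆ ℕ` and their inverses. The letter `(x, true)`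
stands for `x` and `(x, false)` for its inverse. -/
def wordCode {X : Set ℕ} (w : List (X × Bool)) : ℕ :=
  Encodable.encode (w.map fun p => ((p.1 : ℕ), p.2))

/-- The relators enumerated by the `b`-th computably enumerable set, over the generators `X`. -/
def rels (X : Set ℕ) (b : ℕ) : Set (FreeGroup X) :=
  {r | ∃ w : List (X × Bool), wordCode w ∈ W b ∧ FreeGroup.mk w = r}

/-- The set of indices of recursive presentations. An index is a (coded) pair `(a, b)`, where `a` is
a program deciding a set of generators, and `b` is a program for a computably enumerable set of
(codes of) words in these generators and their inverses, the relators. -/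
def presentationIndices : Set ℕ :=
  {e | (∀ n, phi e.unpair.1 n = Part.some 0 ∨ phi e.unpair.1 n = Part.some 1) ∧
    ∀ m ∈ W e.unpair.2, ∃ w : List (gens e.unpair.1 × Bool), wordCode w = m}

/-- The group presented by the recursive presentation with index `e`. -/
abbrev presented (e : ℕ) : Type :=
  PresentedGroup (rels (gens e.unpair.1) e.unpair.2)

/-- A group is recursively presented if it is isomorphic to the group given by some recursive
presentation. -/
def IsRecursivelyPresented (G : Type) [Group G] : Prop :=
  ∃ e ∈ presentationIndices, Nonempty (G ≃* presented e)

/-- An (abstract) property of groups: a predicate on groups that is invariant under isomorphism. -/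
structure GroupProperty where
  holds : (G : Type) → [Group G] → Prop
  iso_invariant : ∀ (G H : Type) [Group G] [Group H], Nonempty (G ≃* H) → holds G → holds H

/-- `P` is Markov for the class `C` of groups: some member of `C` has `P`, and some member of `C`
embeds in no group that has `P`. -/
def IsMarkovFor (C : (G : Type) → [Group G] → Prop) (P : GroupProperty) : Prop :=
  (∃ (Gpos : Type) (_ : Group Gpos), C Gpos ∧ P.holds Gpos) ∧
  (∃ (Gneg : Type) (_ : Group Gneg), C Gneg ∧
    ∀ (H : Type) [Group H], (∃ j : Gneg →* H, Function.Injective j) → ¬ P.holds H)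

/-- `S` is a `Π⁰₂` set of natural numbers. -/
def IsPi02 (S : Set ℕ) : Prop :=
  ∃ R : ℕ × ℕ × ℕ → Prop, ComputablePred R ∧ ∀ n, n ∈ S ↔ ∀ x, ∃ y, R (n, x, y)

/-- Detecting `P` is `Γ`-hard in the index set `A` of recursive presentations: every set `S` in `Γ`
is reducible, by a computable function with values in `A`, to the set of those indices in `A`
whose groups have property `P`. -/
def DetectionHardIn (Γ : Set ℕ → Prop) (A : Set ℕ) (P : GroupProperty) : Prop :=
  ∀ S : Set ℕ, Γ S → ∃ f : ℕ → ℕ, Computable f ∧ (∀ n, f n ∈ A) ∧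
    ∀ n, n ∈ S ↔ f n ∈ {e ∈ A | P.holds (presented e)}

end RPGroups

/-!
The groups in question need not be finitely generated, so a `Π⁰₂` condition can be coded by an
infinite free product. Let `n ∈ S ↔ ∀ x, ∃ y, R (n, x, y)` with `R` decidable. Take the free product
of one copy of `G₊` with copies of `G₋` indexed by `x ∈ ℕ`, and kill the generators of the copy with
index `x` as soon as some `y` with `R (n, x, y)` is found. The generating set stays decidable, since
no generator is removed, and the relators are computably enumerable, uniformly in `n`. If `n ∈ S`,
then all copies of `G₋` are killed and the group is `G₊`. If `n ∉ S`, then some copy of `G₋`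
survives; it is a retract of the group and hence embeds in it.

The group theory is in `RPGroups.IsPrunedFreeProduct.exists_hom_injective`: the canonical map from a
surviving factor is injective, and it is surjective if no other factor survives. The computability
is in `RPGroups.exists_computable_isPrunedFreeProduct`, which rests on closure properties of
computably enumerable predicates and on the `s-m-n` theorem (`Nat.Partrec.Code.curry`).
-/

namespace RPGroups

open Encodable

/-! ### Closure properties of computably enumerable predicates -/

section RE

variable {α β : Type*} [Primcodable α] [Primcodable β]

theorem rePred_comp {p : β → Prop} (hp : REPred p) {f : α → β} (hf : Computable f) :
    REPred fun a => p (f a) :=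
  Partrec.comp hp hf

theorem rePred_and {p q : α → Prop} (hp : REPred p) (hq : REPred q) :
    REPred fun a => p a ∧ q a := by
  have hq' : Partrec₂ fun (a : α) (_ : Unit) => Part.assert (q a) fun _ => Part.some () :=
    (Partrec.comp hq Computable.fst).to₂
  exact (Partrec.bind hp hq').dom_re.of_eq fun a => by
    simp [Part.dom_iff_mem, Part.mem_assert_iff]

theorem rePred_or {p q : α → Prop} (hp : REPred p) (hq : REPred q) :
    REPred fun a => p a ∨ q a := by
  obtain ⟨k, hk, h⟩ := Partrec.merge hp hq fun _ _ _ _ _ => rfl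
  exact hk.dom_re.of_eq fun a => by
    simp [Part.dom_iff_mem, h, Part.mem_assert_iff]

theorem rePred_eq {f g : α → β} (hf : Computable f) (hg : Computable g) :
    REPred fun a => f a = g a := by
  classical
  have h : Computable fun a => decide (encode (f a) = encode (g a)) :=
    (Primrec.eq (α := ℕ)).decide.to_comp.comp (Computable.encode.comp hf)
      (Computable.encode.comp hg)
  exact (ComputablePred.to_re ⟨inferInstance, h⟩).of_eq fun a => encode_inj

theorem rePred_mem {f : α →. β} {g : α → β} (hf : Partrec f) (hg : Computable g) :
    REPred fun a => g a ∈ f a := by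
  have h : Partrec₂ fun (a : α) (b : β) => Part.assert (b = g a) fun _ => Part.some () :=
    (rePred_eq (α := α × β) Computable.snd (hg.comp Computable.fst)).to₂
  exact (Partrec.bind hf h).dom_re.of_eq fun a => by
    simp [Part.dom_iff_mem, Part.mem_assert_iff]

/-- A computably enumerable predicate is the projection of a decidable one: the second variable
bounds the running time. -/
theorem exists_computable_of_rePred {p : α → Prop} (hp : REPred p) :
    ∃ q : α → ℕ → Bool, Computable₂ q ∧ ∀ a, p a ↔ ∃ k, q a k = true := by
  obtain ⟨c, hc⟩ := Nat.Partrec.Code.exists_code.1 hp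
  refine ⟨fun a k => (Nat.Partrec.Code.evaln k c (encode a)).isSome, ?_, fun a => ?_⟩
  · exact (Primrec.option_isSome.comp (Nat.Partrec.Code.primrec_evaln.comp
      ((Primrec.snd.pair (Primrec.const c)).pair
        (Primrec.encode.comp Primrec.fst)))).to_comp.to₂
  · have h : p a ↔ (Nat.Partrec.Code.eval c (encode a)).Dom := by
      rw [hc]
      simp [Part.dom_iff_mem, Part.mem_assert_iff]
    simp only [h, Part.dom_iff_mem, Nat.Partrec.Code.evaln_complete, Option.isSome_iff_exists]
    exact exists_comm

theorem rePred_exists {p : α → β → Prop} (hp : REPred fun x : α × β => p x.1 x.2) :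
    REPred fun a => ∃ b, p a b := by
  obtain ⟨q, hq, h⟩ := exists_computable_of_rePred hp
  have hq' : Computable₂ fun (x : α × ℕ) (b : β) =>
      bif q (x.1, b) x.2.unpair.2 then some () else none := by
    have h1 : Computable fun y : (α × ℕ) × β => (y.1.1, y.2) :=
      (Computable.fst.comp Computable.fst).pair Computable.snd
    have h2 : Computable fun y : (α × ℕ) × β => y.1.2.unpair.2 :=
      Computable.snd.comp (Computable.unpair.comp (Computable.snd.comp Computable.fst))
    have h3 : Computable fun y : (α × ℕ) × β => q (y.1.1, y.2) y.1.2.unpair.2 := hq.comp h1 h2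
    exact Computable.cond h3 (Computable.const (some ())) (Computable.const none)
  have hd : Computable fun x : α × ℕ => decode (α := β) x.2.unpair.1 :=
    Computable.decode.comp (Computable.fst.comp (Computable.unpair.comp Computable.snd))
  -- Dovetailing: the search runs through all pairs of a candidate `b` and a time bound.
  have hs : Computable₂ fun (a : α) (m : ℕ) => (decode (α := β) m.unpair.1).bind fun b =>
      bif q (a, b) m.unpair.2 then some () else none :=
    (Computable.option_bind hd hq').to₂
  refine (Partrec.rfindOpt hs).dom_re.of_eq fun a => ?_
  rw [Nat.rfindOpt_dom]
  constructor
  · rintro ⟨m, u, hu⟩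
    obtain ⟨b, -, hb⟩ := Option.bind_eq_some_iff.1 hu
    refine ⟨b, (h (a, b)).2 ⟨m.unpair.2, ?_⟩⟩
    cases hqb : q (a, b) m.unpair.2
    · rw [hqb] at hb
      cases hb
    · rfl
  · rintro ⟨b, hb⟩
    obtain ⟨k, hk⟩ := (h (a, b)).1 hb
    exact ⟨Nat.pair (encode b) k, (), by simp [hk]⟩

/-- The `s-m-n` theorem for computably enumerable sets: the fibres of a computably enumerable
relation have indices that are computable from the parameter. -/
theorem exists_computable_mem_W {p : ℕ → ℕ → Prop} (hp : REPred fun x : ℕ × ℕ => p x.1 x.2) :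
    ∃ b : ℕ → ℕ, Computable b ∧ ∀ n m, m ∈ W (b n) ↔ p n m := by
  have h : Partrec fun m : ℕ =>
      (Part.assert (p m.unpair.1 m.unpair.2) fun _ => Part.some ()).map fun _ => 0 :=
    (Partrec.comp hp Computable.unpair).map (Computable.const 0).to₂
  obtain ⟨c, hc⟩ := Nat.Partrec.Code.exists_code.1 (Partrec.nat_iff.1 h)
  refine ⟨fun n => encode (c.curry n), Computable.encode.comp
    (Nat.Partrec.Code.primrec₂_curry.to_comp.comp (Computable.const c) Computable.id), fun n m => ?_⟩
  simp [W, phi, Denumerable.ofNat_encode, Nat.Partrec.Code.eval_curry, hc, Part.dom_iff_mem,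
    Part.mem_assert_iff]

theorem partrec_phi {a : α → ℕ} {m : α → ℕ} (ha : Computable a) (hm : Computable m) :
    Partrec fun x => phi (a x) (m x) :=
  Nat.Partrec.Code.eval_part.comp ((Computable.ofNat _).comp ha) hm

end RE

/-! ### Presentations and words -/

section Words

variable {H : Type*} [Group H]

/-- The value of a word at an assignment `F` of group elements to natural numbers, where
`(x, true)` stands for `x` and `(x, false)` for its inverse. -/
def evalWord (F : ℕ → H) (v : List (ℕ × Bool)) : H :=
  (v.map fun p => cond p.2 (F p.1) (F p.1)⁻¹).prod

theorem map_evalWord {H' : Type*} [Group H'] (φ : H →* H') (F : ℕ → H) (v : List (ℕ × Bool)) :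
    φ (evalWord F v) = evalWord (fun x => φ (F x)) v := by
  rw [evalWord, evalWord, map_list_prod, List.map_map]
  congr 2
  funext p
  rcases p with ⟨x, _ | _⟩ <;> simp

theorem evalWord_map (F : ℕ → H) (t : ℕ → ℕ) (v : List (ℕ × Bool)) :
    evalWord F (v.map (Prod.map t id)) = evalWord (fun x => F (t x)) v := by
  simp [evalWord, Function.comp_def]

theorem exists_wordCode_eq_encode_iff {X : Set ℕ} (v : List (ℕ × Bool)) :
    (∃ w : List (X × Bool), wordCode w = encode v) ↔ ∀ p ∈ v, p.1 ∈ X := by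
  have h := Set.ext_iff.1 (Set.range_list_map fun p : X × Bool => ((p.1 : ℕ), p.2)) v
  simpa [wordCode, encode_inj] using h

variable {e : ℕ}

theorem mem_gens_of_mem_W (he : e ∈ presentationIndices) {v : List (ℕ × Bool)}
    (hv : encode v ∈ W e.unpair.2) : ∀ p ∈ v, p.1 ∈ gens e.unpair.1 :=
  (exists_wordCode_eq_encode_iff v).1 (he.2 _ hv)

open Classical in
/-- The generator `x` of the group presented by `e`, with the value `1` if `x` is not among the
generators. -/
noncomputable def generator (e : ℕ) (x : ℕ) : presented e :=
  if h : x ∈ gens e.unpair.1 then PresentedGroup.of ⟨x, h⟩ else 1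

theorem generator_coe (x : gens e.unpair.1) : generator e x = PresentedGroup.of x := by
  simp [generator]

theorem hom_ext_generator {φ ψ : presented e →* H}
    (h : ∀ x ∈ gens e.unpair.1, φ (generator e x) = ψ (generator e x)) : φ = ψ :=
  PresentedGroup.ext fun x => by simpa [generator_coe] using h x x.2

theorem lift_mk_eq_evalWord (F : ℕ → H) {X : Set ℕ} (w : List (X × Bool)) :
    FreeGroup.lift (fun x : X => F x) (FreeGroup.mk w) =
      evalWord F (w.map fun p => ((p.1 : ℕ), p.2)) := by
  simp [FreeGroup.lift_mk, evalWord, Function.comp_def]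

theorem evalWord_generator_eq_one (he : e ∈ presentationIndices) {v : List (ℕ × Bool)}
    (hv : encode v ∈ W e.unpair.2) : evalWord (generator e) v = 1 := by
  obtain ⟨w, hw⟩ := he.2 _ hv
  obtain rfl : w.map (fun p => ((p.1 : ℕ), p.2)) = v := encode_injective hw
  rw [← lift_mk_eq_evalWord]
  have h1 : FreeGroup.lift (fun x : gens e.unpair.1 => generator e x) =
      PresentedGroup.mk (rels (gens e.unpair.1) e.unpair.2) := by
    ext x
    simp [generator_coe, PresentedGroup.of]
  rw [h1]
  exact PresentedGroup.one_of_mem ⟨w, hv, rfl⟩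

/-- The universal property of the group presented by `e`, for assignments defined on all natural
numbers. -/
theorem exists_hom_generator (F : ℕ → H)
    (h : ∀ v : List (ℕ × Bool), encode v ∈ W e.unpair.2 → evalWord F v = 1) :
    ∃ φ : presented e →* H, ∀ x ∈ gens e.unpair.1, φ (generator e x) = F x := by
  have hF : ∀ r ∈ rels (gens e.unpair.1) e.unpair.2,
      FreeGroup.lift (fun x : gens e.unpair.1 => F x) r = 1 := by
    rintro _ ⟨w, hw, rfl⟩
    rw [lift_mk_eq_evalWord]
    exact h _ hw
  refine ⟨PresentedGroup.toGroup hF, fun x hx => ?_⟩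
  rw [generator_coe ⟨x, hx⟩]
  exact PresentedGroup.toGroup.of hF

end Words

/-! ### Free products with killed factors -/

/-- The number `m` codes a relator of the free product of the groups presented by `e i`, for `i ∈ ℕ`,
with all generators of the factors `i ∈ K` killed. The generator `x` of the factor `i` is coded as
`Nat.pair i x`. -/
def IsRelatorCode (e : ℕ → ℕ) (K : ℕ → Prop) (m : ℕ) : Prop :=
  (∃ i, ∃ v : List (ℕ × Bool), encode v ∈ W (e i).unpair.2 ∧
    m = encode (v.map (Prod.map (Nat.pair i) id))) ∨
  ∃ i x, K i ∧ x ∈ gens (e i).unpair.1 ∧ m = encode [(Nat.pair i x, true)]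

/-- The number `d` is an index of the free product of the groups presented by `e i`, for `i ∈ ℕ`,
with all generators of the factors `i ∈ K` killed. -/
structure IsPrunedFreeProduct (e : ℕ → ℕ) (K : ℕ → Prop) (d : ℕ) : Prop where
  mem_indices : d ∈ presentationIndices
  mem_gens : ∀ t, t ∈ gens d.unpair.1 ↔ t.unpair.2 ∈ gens (e t.unpair.1).unpair.1
  mem_rels : ∀ m, m ∈ W d.unpair.2 ↔ IsRelatorCode e K m

/-- A surviving factor is a retract of the pruned free product, and it is the whole group if no
other factor survives. -/
theorem IsPrunedFreeProduct.exists_hom_injective {e : ℕ → ℕ} {K : ℕ → Prop} {d : ℕ}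
    (h : IsPrunedFreeProduct e K d) (he : ∀ i, e i ∈ presentationIndices) {i : ℕ} (hi : ¬ K i) :
    ∃ ι : presented (e i) →* presented d, Function.Injective ι ∧
      ((∀ j, j ≠ i → K j) → Function.Surjective ι) := by
  classical
  obtain ⟨ι, hι⟩ := exists_hom_generator (e := e i) (fun x => generator d (Nat.pair i x))
    fun v hv => by
      rw [← evalWord_map]
      exact evalWord_generator_eq_one h.mem_indices ((h.mem_rels _).2 (.inl ⟨i, v, hv, rfl⟩))
  obtain ⟨π, hπ⟩ := exists_hom_generator (e := d)
    (fun t => if t.unpair.1 = i then generator (e i) t.unpair.2 else 1) fun v hv => by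
      obtain ⟨j, u, hu, hv⟩ | ⟨j, x, hj, -, hv⟩ := (h.mem_rels _).1 hv
      · rw [encode_injective hv, evalWord_map]
        by_cases hji : j = i
        · subst hji
          simpa using evalWord_generator_eq_one (he j) hu
        · simp [hji, evalWord]
      · have hji : j ≠ i := fun hji => hi (hji ▸ hj)
        simp [encode_injective hv, evalWord, hji]
  have hgens : ∀ x ∈ gens (e i).unpair.1, Nat.pair i x ∈ gens d.unpair.1 := fun x hx =>
    (h.mem_gens _).2 (by simpa using hx)
  refine ⟨ι, ?_, fun hK => ?_⟩
  · have hid : π.comp ι = MonoidHom.id _ := hom_ext_generator fun x hx => by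
      simp [hι x hx, hπ _ (hgens x hx)]
    exact Function.LeftInverse.injective (g := π) (DFunLike.congr_fun hid)
  · have hid : ι.comp π = MonoidHom.id _ := hom_ext_generator fun t ht => by
      have ht' := (h.mem_gens t).1 ht
      by_cases hti : t.unpair.1 = i
      · rw [hti] at ht'
        have htp : Nat.pair i t.unpair.2 = t := by rw [← hti, Nat.pair_unpair]
        simp [hπ t ht, hti, hι _ ht', htp]
      · have := evalWord_generator_eq_one (v := [(t, true)]) h.mem_indices
          ((h.mem_rels _).2 (.inr ⟨t.unpair.1, t.unpair.2, hK _ hti, ht', by simp⟩))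
        simpa [hπ t ht, hti, evalWord] using this.symm
    exact Function.RightInverse.surjective (g := π) (DFunLike.congr_fun hid)

/-! ### Computing indices of pruned free products -/

theorem rePred_factor_relator {e : ℕ → ℕ} (he : Computable e) :
    REPred fun y : ℕ × ℕ => ∃ i, ∃ v : List (ℕ × Bool), encode v ∈ W (e i).unpair.2 ∧
      y.2 = encode (v.map (Prod.map (Nat.pair i) id)) := by
  refine rePred_exists (rePred_exists ?_)
  have he2 : Computable fun i => (e i).unpair.2 :=
    Computable.snd.comp (Computable.unpair.comp he)
  have hi : Computable fun z : ((ℕ × ℕ) × ℕ) × List (ℕ × Bool) => z.1.2 :=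
    Computable.snd.comp Computable.fst
  have hmap : Primrec fun z : ((ℕ × ℕ) × ℕ) × List (ℕ × Bool) =>
      z.2.map (Prod.map (Nat.pair z.1.2) id) := by
    have h1 : Primrec fun y : (((ℕ × ℕ) × ℕ) × List (ℕ × Bool)) × (ℕ × Bool) => y.1.1.2 :=
      Primrec.snd.comp (Primrec.fst.comp Primrec.fst)
    have h2 : Primrec fun y : (((ℕ × ℕ) × ℕ) × List (ℕ × Bool)) × (ℕ × Bool) => y.2.1 :=
      Primrec.fst.comp Primrec.snd
    have h3 : Primrec fun y : (((ℕ × ℕ) × ℕ) × List (ℕ × Bool)) × (ℕ × Bool) => y.2.2 :=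
      Primrec.snd.comp Primrec.snd
    exact Primrec.list_map Primrec.snd ((Primrec₂.natPair.comp h1 h2).pair h3).to₂
  have hm : Computable fun z : ((ℕ × ℕ) × ℕ) × List (ℕ × Bool) => z.1.1.2 :=
    Computable.snd.comp (Computable.fst.comp Computable.fst)
  have hb : Computable fun z : ((ℕ × ℕ) × ℕ) × List (ℕ × Bool) => (e z.1.2).unpair.2 :=
    he2.comp hi
  have hv : Computable fun z : ((ℕ × ℕ) × ℕ) × List (ℕ × Bool) => encode z.2 :=
    Computable.encode.comp Computable.snd
  have hw : Computable fun z : ((ℕ × ℕ) × ℕ) × List (ℕ × Bool) =>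
      encode (z.2.map (Prod.map (Nat.pair z.1.2) id)) :=
    Computable.encode.comp hmap.to_comp
  exact rePred_and (partrec_phi hb hv).dom_re (rePred_eq hm hw)

theorem rePred_killing_relator {e : ℕ → ℕ} (he : Computable e) {K : ℕ → ℕ → Prop}
    (hK : REPred fun x : ℕ × ℕ => K x.1 x.2) :
    REPred fun y : ℕ × ℕ => ∃ i x, K y.1 i ∧ x ∈ gens (e i).unpair.1 ∧
      y.2 = encode [(Nat.pair i x, true)] := by
  refine rePred_exists (rePred_exists ?_)
  have he1 : Computable fun i => (e i).unpair.1 :=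
    Computable.fst.comp (Computable.unpair.comp he)
  have hi : Computable fun z : ((ℕ × ℕ) × ℕ) × ℕ => z.1.2 :=
    Computable.snd.comp Computable.fst
  have hx : Computable fun z : ((ℕ × ℕ) × ℕ) × ℕ => z.2 := Computable.snd
  have hn : Computable fun z : ((ℕ × ℕ) × ℕ) × ℕ => z.1.1.1 :=
    Computable.fst.comp (Computable.fst.comp Computable.fst)
  have hm : Computable fun z : ((ℕ × ℕ) × ℕ) × ℕ => z.1.1.2 :=
    Computable.snd.comp (Computable.fst.comp Computable.fst)
  have ha : Computable fun z : ((ℕ × ℕ) × ℕ) × ℕ => (e z.1.2).unpair.1 := he1.comp hi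
  have hpair : Computable fun z : ((ℕ × ℕ) × ℕ) × ℕ => Nat.pair z.1.2 z.2 :=
    Primrec₂.natPair.to_comp.comp hi hx
  have hletter : Computable fun z : ((ℕ × ℕ) × ℕ) × ℕ => (Nat.pair z.1.2 z.2, true) :=
    hpair.pair (Computable.const true)
  have hword : Computable fun z : ((ℕ × ℕ) × ℕ) × ℕ => [(Nat.pair z.1.2 z.2, true)] :=
    Computable.list_cons.comp hletter (Computable.const [])
  have hw : Computable fun z : ((ℕ × ℕ) × ℕ) × ℕ => encode [(Nat.pair z.1.2 z.2, true)] :=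
    Computable.encode.comp hword
  have hkill := rePred_comp hK (hn.pair hi)
  have hgen : REPred fun z : ((ℕ × ℕ) × ℕ) × ℕ => 1 ∈ phi (e z.1.2).unpair.1 z.2 :=
    rePred_mem (partrec_phi ha hx) (Computable.const 1)
  have hcode : REPred fun z : ((ℕ × ℕ) × ℕ) × ℕ =>
      z.1.1.2 = encode [(Nat.pair z.1.2 z.2, true)] := rePred_eq hm hw
  exact rePred_and hkill (rePred_and hgen hcode)

/-- A pruned free product of a computable sequence of presentations, with a computably enumerable
set of killed factors depending on a parameter, has an index computable from the parameter. -/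
theorem exists_computable_isPrunedFreeProduct {e : ℕ → ℕ} (he : Computable e)
    (hA : ∀ i, e i ∈ presentationIndices) {K : ℕ → ℕ → Prop}
    (hK : REPred fun x : ℕ × ℕ => K x.1 x.2) :
    ∃ f : ℕ → ℕ, Computable f ∧ ∀ n, IsPrunedFreeProduct e (K n) (f n) := by
  have he1 : Computable fun i => (e i).unpair.1 :=
    Computable.fst.comp (Computable.unpair.comp he)
  have hu1 : Computable fun t : ℕ => t.unpair.1 := Computable.fst.comp Computable.unpair
  have hu2 : Computable fun t : ℕ => t.unpair.2 := Computable.snd.comp Computable.unpair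
  obtain ⟨c, hc⟩ := Nat.Partrec.Code.exists_code.1
    (Partrec.nat_iff.1 (partrec_phi (he1.comp hu1) hu2))
  have hphi : ∀ t, phi (encode c) t = phi (e t.unpair.1).unpair.1 t.unpair.2 := fun t => by
    conv_lhs => rw [phi, Denumerable.ofNat_encode, hc]
  obtain ⟨b, hb, hW⟩ := exists_computable_mem_W (p := fun n => IsRelatorCode e (K n))
    (rePred_or (rePred_factor_relator he) (rePred_killing_relator he hK))
  have hgens : ∀ t, t ∈ gens (encode c) ↔ t.unpair.2 ∈ gens (e t.unpair.1).unpair.1 := fun t => by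
    simp only [gens, Set.mem_ofPred_eq, hphi]
  refine ⟨fun n => Nat.pair (encode c) (b n),
    Primrec₂.natPair.to_comp.comp (Computable.const _) hb, fun n => ⟨⟨fun t => ?_, fun m hm => ?_⟩,
      fun t => ?_, fun m => ?_⟩⟩
  · rw [Nat.unpair_pair, hphi]
    exact (hA _).1 _
  · rw [Nat.unpair_pair] at hm ⊢
    obtain ⟨i, v, hv, rfl⟩ | ⟨i, x, -, hx, rfl⟩ := (hW n m).1 hm
    · refine (exists_wordCode_eq_encode_iff _).2 fun p hp => ?_
      obtain ⟨q, hq, rfl⟩ := List.mem_map.1 hp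
      exact (hgens _).2 (by simpa using mem_gens_of_mem_W (hA i) hv q hq)
    · refine (exists_wordCode_eq_encode_iff _).2 fun p hp => ?_
      obtain rfl := List.mem_singleton.1 hp
      exact (hgens _).2 (by simpa using hx)
  · rw [Nat.unpair_pair]
    exact hgens t
  · rw [Nat.unpair_pair]
    exact hW n m

end RPGroups

open RPGroups in
theorem mainTheorem1 (P : RPGroups.GroupProperty)
    (hP : RPGroups.IsMarkovFor (fun G [Group G] => RPGroups.IsRecursivelyPresented G) P) :
    RPGroups.DetectionHardIn RPGroups.IsPi02 RPGroups.presentationIndices P := by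
  obtain ⟨⟨Gpos, _, ⟨p, hpA, ⟨isoPos⟩⟩, hpos⟩, Gneg, _, ⟨q, hqA, ⟨isoNeg⟩⟩, hneg⟩ := hP
  rintro S ⟨R, hR, hS⟩
  -- The factor `0` is the positive witness and is never killed; the factor `x + 1` is a copy of the
  -- negative witness.
  let e : ℕ → ℕ := fun i => i.casesOn p fun _ => q
  have he : Computable e :=
    Computable.nat_casesOn Computable.id (Computable.const p) (Computable.const q).to₂
  have hA : ∀ i, e i ∈ presentationIndices := by rintro (_ | _) <;> assumption
  let K : ℕ → ℕ → Prop := fun n i => ∃ x y, i = x + 1 ∧ R (n, x, y)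
  have hK : REPred fun z : ℕ × ℕ => K z.1 z.2 := by
    refine rePred_exists (rePred_exists (rePred_and (rePred_eq ?_ ?_) (rePred_comp hR.to_re ?_)))
    · exact Computable.snd.comp (Computable.fst.comp Computable.fst)
    · exact Computable.succ.comp (Computable.snd.comp Computable.fst)
    · exact (Computable.fst.comp (Computable.fst.comp Computable.fst)).pair
        ((Computable.snd.comp Computable.fst).pair Computable.snd)
  obtain ⟨f, hf, hfK⟩ := exists_computable_isPrunedFreeProduct he hA hK
  refine ⟨f, hf, fun n => (hfK n).mem_indices, fun n => ⟨fun hn => ?_, fun hn => ?_⟩⟩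
  · refine ⟨(hfK n).mem_indices, ?_⟩
    have h0 : ¬ K n 0 := by rintro ⟨x, y, h, -⟩; omega
    obtain ⟨ι, hinj, hsurj⟩ := (hfK n).exists_hom_injective hA h0
    have hbij : Function.Bijective ι := ⟨hinj, hsurj fun j hj => by
      obtain ⟨x, rfl⟩ := Nat.exists_eq_succ_of_ne_zero hj
      obtain ⟨y, hy⟩ := (hS n).1 hn x
      exact ⟨x, y, rfl, hy⟩⟩
    exact P.iso_invariant _ _ ⟨isoPos.trans (MulEquiv.ofBijective ι hbij)⟩ hpos
  · by_contra hnS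
    obtain ⟨x, hx⟩ : ∃ x, ¬ ∃ y, R (n, x, y) := by
      simpa only [hS, not_forall] using hnS
    have hx1 : ¬ K n (x + 1) := by
      rintro ⟨x', y, h, hy⟩
      obtain rfl : x = x' := by omega
      exact hx ⟨y, hy⟩
    obtain ⟨ι, hinj, -⟩ := (hfK n).exists_hom_injective hA hx1
    exact hneg _ ⟨ι.comp isoNeg.toMonoidHom, hinj.comp isoNeg.injective⟩ hn.2
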